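/- Let $1\to F\to G\to \bar G\to 1$ be a short exact sequence of groups, where $F$ is finite and $G$ is residually finite, and suppose that $\bar G$ admits a discrete and faithful representation $\bar\rho:\bar G\to \operatorname{Isom}(\mathbb H^n)$ for some $n$. Then there are an $m$ and a discrete and faithful representation $\rho: G\to \operatorname{Isom}(\mathbb H^m)$; moreover $\rho$ can be chosen so that if $\bar\rho(\bar G)$ is convex-cocompact (resp. geometrically finite), then $\rho(G)$ is convex-cocompact (resp. geometrically finite). Here $\mathbb H^n$ is real-hyperbolic $n$-space of curvature $-1$, and a representation into $\operatorname{Isom}(\mathbb H^n)$ is discrete if its image is a discrete subgroup. A discrete subgroup $\Gamma\subset\operatorname{Isom}(\mathbb H^n)$ is convex-cocompact if there is a smallest (that is, minimal for inclusion) nonempty closed convex $\Gamma$-invariant subset $C\subset\mathbb H^n$ with compact quotient $C/\Gamma$. It is geometrically finite if every point $\xi$ of its limit set $\Lambda(\Gamma)\subset S^{n-1}$ is either a conical limit point (for some geodesic ray ending at $\xi$, a $\Gamma$-orbit has points arbitrarily far along the ray within a bounded distance of it) or a bounded parabolic point ($\xi$ is fixed by a parabolic element of $\Gamma$, and $(\Lambda(\Gamma)\setminus\{\xi\})/\operatorname{Stab}_\Gamma(\xi)$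 is compact). -/

import Mathlib

open Filter Topology

noncomputable section

/-- Real hyperbolic `n`-space, in the hyperboloid model: the upper sheet
`t ^ 2 - ‖u‖ ^ 2 = 1`, `t > 0`, in `ℝⁿ × ℝ`. -/
@[ext]
structure HyperbolicSpace (n : ℕ) where
  space : EuclideanSpace ℝ (Fin n)
  time : ℝ
  time_pos : 0 < time
  time_sq : time ^ 2 = ‖space‖ ^ 2 + 1

namespace HyperbolicSpace

variable {n : ℕ}

/-- The point of the hyperboloid lying above `u`. -/
def ofSpace (u : EuclideanSpace ℝ (Fin n)) : HyperbolicSpace n where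
  space := u
  time := √(‖u‖ ^ 2 + 1)
  time_pos := by positivity
  time_sq := Real.sq_sqrt (by positivity)

/-- The base point `(0, 1)` of the hyperboloid. -/
def origin (n : ℕ) : HyperbolicSpace n := ofSpace 0

/-- The Lorentz pairing `t t' - ⟪u, u'⟫`, which is the hyperbolic cosine of the distance. -/
def lorentz (x y : HyperbolicSpace n) : ℝ := x.time * y.time - inner ℝ x.space y.space

theorem lorentz_comm (x y : HyperbolicSpace n) : lorentz x y = lorentz y x := by
  simp only [lorentz, real_inner_comm, mul_comm]

theorem lorentz_self (x : HyperbolicSpace n) : lorentz x x = 1 := by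
  simp only [lorentz, real_inner_self_eq_norm_sq]
  nlinarith [x.time_sq]

theorem norm_space_lt_time (x : HyperbolicSpace n) : ‖x.space‖ < x.time := by
  nlinarith [x.time_sq, x.time_pos, norm_nonneg x.space]

theorem one_le_lorentz (x y : HyperbolicSpace n) : 1 ≤ lorentz x y := by
  have h := real_inner_le_norm x.space y.space
  have hx := x.time_sq
  have hy := y.time_sq
  have hxy : ‖x.space‖ * ‖y.space‖ + 1 ≤ x.time * y.time := by
    apply le_of_sq_le_sq _ (mul_pos x.time_pos y.time_pos).le
    rw [mul_pow, hx, hy]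
    nlinarith [sq_nonneg (‖x.space‖ - ‖y.space‖)]
  simp only [lorentz]
  linarith

theorem eq_of_lorentz_eq_one {x y : HyperbolicSpace n} (h : lorentz x y = 1) : x = y := by
  have hx := x.time_sq
  have hy := y.time_sq
  have hc := real_inner_le_norm x.space y.space
  have hd : ‖x.space - y.space‖ ^ 2 = (x.time - y.time) ^ 2 := by
    rw [norm_sub_sq_real]
    simp only [lorentz] at h
    nlinarith
  have hle : (x.time - y.time) ^ 2 ≤ 0 := by
    have h1 : x.time * y.time ≤ 1 + ‖x.space‖ * ‖y.space‖ := by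
      simp only [lorentz] at h
      linarith
    have h2 : (x.time * y.time) ^ 2 ≤ (1 + ‖x.space‖ * ‖y.space‖) ^ 2 :=
      pow_le_pow_left₀ (mul_pos x.time_pos y.time_pos).le h1 2
    rw [mul_pow, hx, hy] at h2
    have h3 : ‖x.space‖ = ‖y.space‖ := by nlinarith [sq_nonneg (‖x.space‖ - ‖y.space‖)]
    have h4 : x.time = y.time := by
      rw [← sq_eq_sq₀ x.time_pos.le y.time_pos.le, hx, hy, h3]
    simp [h4]
  have h0 : (x.time - y.time) ^ 2 = 0 := le_antisymm hle (sq_nonneg _)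
  rw [h0] at hd
  have hs : x.space = y.space := by
    simpa [sub_eq_zero] using hd
  have ht : x.time = y.time := by
    simpa [sub_eq_zero] using h0
  exact HyperbolicSpace.ext hs ht

theorem lorentz_le (x y z : HyperbolicSpace n) :
    lorentz x z ≤ lorentz x y * lorentz y z +
      √(lorentz x y ^ 2 - 1) * √(lorentz y z ^ 2 - 1) := by
  have key : ∀ r : ℝ, 0 ≤ (lorentz x y ^ 2 - 1) * (r * r) +
      (2 * (lorentz x y * lorentz y z - lorentz x z)) * r + (lorentz y z ^ 2 - 1) := by
    intro r
    set c : ℝ := r * lorentz x y + lorentz y z with hc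
    set a : EuclideanSpace ℝ (Fin n) := r • x.space + z.space - c • y.space with ha
    set s : ℝ := r * x.time + z.time - c * y.time with hs
    have horth : inner ℝ a y.space = s * y.time := by
      simp only [ha, hs, hc, inner_sub_left, inner_add_left, real_inner_smul_left,
        real_inner_self_eq_norm_sq, lorentz, real_inner_comm z.space y.space]
      have := y.time_sq
      have h2 : ‖y.space‖ ^ 2 = y.time ^ 2 - 1 := by linarith
      rw [h2]
      ring
    have hle : s ^ 2 ≤ ‖a‖ ^ 2 := by
      have h1 := real_inner_mul_inner_self_le a y.space
      rw [horth, real_inner_self_eq_norm_sq, real_inner_self_eq_norm_sq] at h1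
      have h2 := y.time_sq
      have h3 : 0 < y.time ^ 2 := pow_pos y.time_pos 2
      have h4 : s ^ 2 * y.time ^ 2 ≤ ‖a‖ ^ 2 * y.time ^ 2 := by
        nlinarith [sq_nonneg ‖a‖]
      exact le_of_mul_le_mul_right h4 h3
    have hexp : ‖a‖ ^ 2 - s ^ 2 = (lorentz x y ^ 2 - 1) * (r * r) +
      (2 * (lorentz x y * lorentz y z - lorentz x z)) * r + (lorentz y z ^ 2 - 1) := by
      have hx : inner ℝ x.space x.space = x.time ^ 2 - 1 := by
        rw [real_inner_self_eq_norm_sq]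
        linarith [x.time_sq]
      have hy : inner ℝ y.space y.space = y.time ^ 2 - 1 := by
        rw [real_inner_self_eq_norm_sq]
        linarith [y.time_sq]
      have hz : inner ℝ z.space z.space = z.time ^ 2 - 1 := by
        rw [real_inner_self_eq_norm_sq]
        linarith [z.time_sq]
      rw [← real_inner_self_eq_norm_sq a]
      simp only [ha, hs, hc, inner_sub_left, inner_add_left, real_inner_smul_left,
        inner_sub_right, inner_add_right, real_inner_smul_right,
        hx, hy, hz, lorentz, real_inner_comm x.space z.space,
        real_inner_comm y.space z.space, real_inner_comm x.space y.space]
      ring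
    linarith
  have hd := discrim_le_zero key
  simp only [discrim] at hd
  have hsq : (lorentz x z - lorentz x y * lorentz y z) ^ 2 ≤
      (lorentz x y ^ 2 - 1) * (lorentz y z ^ 2 - 1) := by nlinarith
  have h0 : 0 ≤ lorentz x y ^ 2 - 1 := by nlinarith [one_le_lorentz x y]
  have h := Real.le_sqrt_of_sq_le hsq
  rw [Real.sqrt_mul h0] at h
  linarith

/-- The hyperbolic metric of curvature `-1`. -/
instance : MetricSpace (HyperbolicSpace n) where
  dist x y := Real.arcosh (lorentz x y)
  dist_self x := by simp [lorentz_self]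
  dist_comm x y := by simp only [lorentz_comm]
  dist_triangle x y z := by
    have h1 := Real.arcosh_nonneg (one_le_lorentz x y)
    have h2 := Real.arcosh_nonneg (one_le_lorentz y z)
    rw [← Real.arcosh_cosh (add_nonneg h1 h2)]
    rw [Real.arcosh_le_arcosh (by linarith [one_le_lorentz x z]) (Real.cosh_pos _),
      Real.cosh_add, Real.cosh_arcosh (one_le_lorentz x y), Real.cosh_arcosh (one_le_lorentz y z),
      Real.sinh_arcosh (one_le_lorentz x y), Real.sinh_arcosh (one_le_lorentz y z)]
    exact lorentz_le x y z
  eq_of_dist_eq_zero {x y} h :=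
    eq_of_lorentz_eq_one ((Real.arcosh_eq_zero_iff (one_le_lorentz x y)).1 h)

theorem dist_eq (x y : HyperbolicSpace n) : dist x y = Real.arcosh (lorentz x y) := rfl

/-- The Klein model: it identifies hyperbolic space with the open unit ball, whose boundary
sphere is the sphere at infinity. -/
def toBall (x : HyperbolicSpace n) : EuclideanSpace ℝ (Fin n) := x.time⁻¹ • x.space

/-- The sphere at infinity `S^{n-1}` of hyperbolic `n`-space. -/
abbrev Boundary (n : ℕ) : Type := Metric.sphere (0 : EuclideanSpace ℝ (Fin n)) 1

/-- The filter of points of hyperbolic space that tend to the point `ξ` at infinity. -/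
def atBoundary (ξ : Boundary n) : Filter (HyperbolicSpace n) :=
  comap toBall (𝓝 (ξ : EuclideanSpace ℝ (Fin n)))

theorem norm_toBall_sq (x : HyperbolicSpace n) : ‖toBall x‖ ^ 2 = 1 - (x.time⁻¹) ^ 2 := by
  have h := x.time_pos
  rw [toBall, norm_smul, mul_pow, Real.norm_eq_abs, sq_abs]
  have : ‖x.space‖ ^ 2 = x.time ^ 2 - 1 := by linarith [x.time_sq]
  rw [this]
  field_simp

instance (ξ : Boundary n) : NeBot (atBoundary ξ) := by
  have hξ : ‖(ξ : EuclideanSpace ℝ (Fin n))‖ = 1 := by simp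
  rw [atBoundary, comap_neBot_iff_frequently]
  have hs : Tendsto (fun s : ℝ => s • (ξ : EuclideanSpace ℝ (Fin n))) (𝓝[<] 1)
      (𝓝 (ξ : EuclideanSpace ℝ (Fin n))) := by
    have : Continuous (fun s : ℝ => s • (ξ : EuclideanSpace ℝ (Fin n))) := by fun_prop
    simpa using (this.tendsto 1).mono_left nhdsWithin_le_nhds
  refine hs.frequently (Eventually.frequently ?_)
  have h0 : ∀ᶠ s : ℝ in 𝓝[<] 1, s ∈ Set.Ioo (0 : ℝ) 1 := Ioo_mem_nhdsLT (by norm_num)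
  filter_upwards [h0] with s hs
  have hpos : 0 < 1 - s ^ 2 := by nlinarith [hs.1, hs.2]
  have hq : 0 < √(1 - s ^ 2) := Real.sqrt_pos.2 hpos
  have hq2 : √(1 - s ^ 2) ^ 2 = 1 - s ^ 2 := Real.sq_sqrt hpos.le
  refine ⟨⟨((√(1 - s ^ 2))⁻¹ * s) • (ξ : EuclideanSpace ℝ (Fin n)), (√(1 - s ^ 2))⁻¹,
    inv_pos.2 hq, ?_⟩, ?_⟩
  · rw [norm_smul, hξ, mul_one, Real.norm_eq_abs, sq_abs]
    field_simp
    rw [hq2]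
    ring
  · simp only [toBall, inv_inv, smul_smul]
    congr 1
    field_simp

/-- The group `Isom(ℍⁿ)` of all isometries of hyperbolic space. -/
abbrev Isom (n : ℕ) : Type := HyperbolicSpace n ≃ᵢ HyperbolicSpace n

/-- The compact-open topology on the isometry group. -/
instance : TopologicalSpace (Isom n) :=
  TopologicalSpace.induced
    (fun g => (⟨g, g.continuous⟩ : C(HyperbolicSpace n, HyperbolicSpace n))) inferInstance

instance : MulAction (Isom n) (HyperbolicSpace n) where
  smul g x := g x
  one_smul _ := rfl
  mul_smul _ _ _ := rfl

theorem lorentz_map (g : Isom n) (x y : HyperbolicSpace n) :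
    lorentz (g x) (g y) = lorentz x y :=
  Real.arcosh_injOn (one_le_lorentz _ _) (one_le_lorentz _ _) (g.dist_eq x y)

/-- Isometries extend continuously to the sphere at infinity. -/
theorem exists_tendsto_boundary (g : Isom n) (ξ : Boundary n) :
    ∃ η : Boundary n, Tendsto g (atBoundary ξ) (atBoundary η) := by
  have hξ : ‖(ξ : EuclideanSpace ℝ (Fin n))‖ = 1 := by simp
  have hk : Tendsto toBall (atBoundary ξ) (𝓝 (ξ : EuclideanSpace ℝ (Fin n))) := tendsto_comap
  have hinv : Tendsto (fun x : HyperbolicSpace n => x.time⁻¹) (atBoundary ξ) (𝓝 0) := by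
    have h1 : Tendsto (fun x : HyperbolicSpace n => (x.time⁻¹) ^ 2) (atBoundary ξ) (𝓝 0) := by
      have h2 : Tendsto (fun x : HyperbolicSpace n => 1 - ‖toBall x‖ ^ 2) (atBoundary ξ)
          (𝓝 (1 - ‖(ξ : EuclideanSpace ℝ (Fin n))‖ ^ 2)) := (hk.norm.pow 2).const_sub 1
      rw [hξ] at h2
      simpa [norm_toBall_sq] using h2
    have h3 := h1.sqrt
    simp only [Real.sqrt_zero] at h3
    refine h3.congr fun x => Real.sqrt_sq (inv_pos.2 x.time_pos).le
  -- the limit of `lorentz x y / x.time`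
  set B : HyperbolicSpace n → ℝ := fun y =>
    y.time - inner ℝ (ξ : EuclideanSpace ℝ (Fin n)) y.space with hB
  have hBpos : ∀ y, 0 < B y := by
    intro y
    have h := real_inner_le_norm (ξ : EuclideanSpace ℝ (Fin n)) y.space
    rw [hξ, one_mul] at h
    have := norm_space_lt_time y
    simp only [hB]
    linarith
  have hL : ∀ y, Tendsto (fun x : HyperbolicSpace n => x.time⁻¹ * lorentz x y) (atBoundary ξ)
      (𝓝 (B y)) := by
    intro y
    have h1 : Tendsto (fun x : HyperbolicSpace n => y.time - inner ℝ (toBall x) y.space)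
        (atBoundary ξ) (𝓝 (B y)) := (hk.inner tendsto_const_nhds).const_sub _
    refine h1.congr fun x => ?_
    have := x.time_pos
    simp only [toBall, lorentz, real_inner_smul_left]
    field_simp
  have hg : ∀ y, Tendsto (fun x : HyperbolicSpace n => x.time⁻¹ * lorentz (g x) y)
      (atBoundary ξ) (𝓝 (B (g.symm y))) := by
    intro y
    refine (hL (g.symm y)).congr fun x => ?_
    rw [← lorentz_map g x (g.symm y), g.apply_symm_apply]
  have h0 : Tendsto (fun x : HyperbolicSpace n => x.time⁻¹ * (g x).time)
      (atBoundary ξ) (𝓝 (B (g.symm (origin n)))) := by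
    refine (hg (origin n)).congr fun x => ?_
    simp [lorentz, origin, ofSpace]
  set b : ℝ := B (g.symm (origin n)) with hb
  have hb0 : 0 < b := hBpos _
  have hquot : ∀ y, Tendsto (fun x : HyperbolicSpace n => ((g x).time)⁻¹ * lorentz (g x) y)
      (atBoundary ξ) (𝓝 (b⁻¹ * B (g.symm y))) := by
    intro y
    refine ((h0.inv₀ hb0.ne').mul (hg y)).congr fun x => ?_
    have := x.time_pos
    have := (g x).time_pos
    field_simp
  have hinner : ∀ w : EuclideanSpace ℝ (Fin n),
      Tendsto (fun x : HyperbolicSpace n => inner ℝ (toBall (g x)) w) (atBoundary ξ)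
        (𝓝 ((ofSpace w).time - b⁻¹ * B (g.symm (ofSpace w)))) := by
    intro w
    refine ((hquot (ofSpace w)).const_sub _).congr fun x => ?_
    have := (g x).time_pos
    simp only [toBall, lorentz, real_inner_smul_left, ofSpace]
    field_simp
    ring
  set η : EuclideanSpace ℝ (Fin n) := WithLp.toLp 2 fun i =>
    (ofSpace (EuclideanSpace.single i (1 : ℝ))).time -
      b⁻¹ * B (g.symm (ofSpace (EuclideanSpace.single i (1 : ℝ)))) with hη
  have hlim : Tendsto (fun x => toBall (g x)) (atBoundary ξ) (𝓝 η) := by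
    have h1 : Tendsto (fun x => WithLp.ofLp (toBall (g x))) (atBoundary ξ)
        (𝓝 (WithLp.ofLp η)) := by
      rw [tendsto_pi_nhds]
      intro i
      refine (hinner (EuclideanSpace.single i (1 : ℝ))).congr fun x => ?_
      simp [EuclideanSpace.inner_single_right]
    have h2 := ((PiLp.continuous_toLp 2 (fun _ : Fin n => ℝ)).tendsto (WithLp.ofLp η)).comp h1
    simpa [Function.comp_def] using h2
  have hginv : Tendsto (fun x : HyperbolicSpace n => ((g x).time)⁻¹) (atBoundary ξ) (𝓝 0) := by
    have h := hinv.mul (h0.inv₀ hb0.ne')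
    rw [zero_mul] at h
    refine h.congr fun x => ?_
    have := x.time_pos
    have := (g x).time_pos
    field_simp
  have hnorm : ‖η‖ ^ 2 = 1 := by
    refine tendsto_nhds_unique (hlim.norm.pow 2) ?_
    simp only [norm_toBall_sq]
    simpa using (hginv.pow 2).const_sub 1
  have hη1 : ‖η‖ = 1 := by
    have := norm_nonneg η
    nlinarith
  exact ⟨⟨η, by simpa using hη1⟩, tendsto_comap_iff.2 hlim⟩

theorem boundary_unique {α : Type*} {l : Filter α} [NeBot l] {f : α → HyperbolicSpace n}
    {ξ η : Boundary n} (h₁ : Tendsto f l (atBoundary ξ)) (h₂ : Tendsto f l (atBoundary η)) :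
    ξ = η :=
  Subtype.ext (tendsto_nhds_unique (tendsto_comap_iff.1 h₁) (tendsto_comap_iff.1 h₂))

/-- The action of an isometry on the sphere at infinity, extending its action on hyperbolic
space by continuity. -/
def boundaryMap (g : Isom n) (ξ : Boundary n) : Boundary n :=
  (exists_tendsto_boundary g ξ).choose

theorem tendsto_boundaryMap (g : Isom n) (ξ : Boundary n) :
    Tendsto g (atBoundary ξ) (atBoundary (boundaryMap g ξ)) :=
  (exists_tendsto_boundary g ξ).choose_spec

instance : MulAction (Isom n) (Boundary n) where
  smul g ξ := boundaryMap g ξ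
  one_smul ξ := boundary_unique (tendsto_boundaryMap 1 ξ) tendsto_id
  mul_smul g h ξ := boundary_unique (tendsto_boundaryMap (g * h) ξ)
    ((tendsto_boundaryMap g (boundaryMap h ξ)).comp (tendsto_boundaryMap h ξ))

/-- A discrete subgroup of `Isom(ℍⁿ)`. -/
def IsKleinian (Γ : Subgroup (Isom n)) : Prop := DiscreteTopology Γ

/-- Geodesic convexity; the points `z` with `dist x z + dist z y = dist x y` are those of the
geodesic segment from `x` to `y`. -/
def GeodesicallyConvex (C : Set (HyperbolicSpace n)) : Prop :=
  ∀ x ∈ C, ∀ y ∈ C, ∀ z, dist x z + dist z y = dist x y → z ∈ C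

/-- `C` is a convex hull of `Γ`: a smallest nonempty closed convex `Γ`-invariant set. Smallest is
meant as minimal for inclusion, since for finite `Γ` a convex hull is any single fixed point. -/
def IsConvexHull (Γ : Subgroup (Isom n)) (C : Set (HyperbolicSpace n)) : Prop :=
  Minimal (fun D : Set (HyperbolicSpace n) => D.Nonempty ∧ IsClosed D ∧ GeodesicallyConvex D ∧
    ∀ g ∈ Γ, ∀ x ∈ D, g x ∈ D) C

/-- `Γ` is Kleinian, has a convex hull `C`, and the quotient `C / Γ` (a subspace of `ℍⁿ / Γ`) is
compact. -/
def IsConvexCocompact (Γ : Subgroup (Isom n)) : Prop :=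
  IsKleinian Γ ∧ ∃ C : Set (HyperbolicSpace n), IsConvexHull Γ C ∧
    IsCompact ((Quotient.mk (MulAction.orbitRel Γ (HyperbolicSpace n))) '' C)

/-- The limit set: the accumulation points at infinity of the orbit of the base point
(the orbit of any other point accumulates at the same points). -/
def limitSet (Γ : Subgroup (Isom n)) : Set (Boundary n) :=
  {ξ | (ξ : EuclideanSpace ℝ (Fin n)) ∈
    closure ((fun g : Isom n => toBall (g (origin n))) '' (Γ : Set (Isom n)))}

/-- `ξ` is a conical limit point: for some geodesic ray `c` ending at `ξ`, the orbit of the base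
point meets a fixed neighbourhood of `c` arbitrarily far along `c`. -/
def IsConicalLimitPoint (Γ : Subgroup (Isom n)) (ξ : Boundary n) : Prop :=
  ∃ (c : NNReal → HyperbolicSpace n) (R : ℝ), Isometry c ∧ Tendsto c atTop (atBoundary ξ) ∧
    ∃ᶠ t in atTop, ∃ g ∈ Γ, dist (g (origin n)) (c t) ≤ R

/-- An isometry is parabolic if it has no fixed point in hyperbolic space and exactly one fixed
point at infinity. -/
def IsParabolic (g : Isom n) : Prop :=
  (∀ x : HyperbolicSpace n, g x ≠ x) ∧ ∃! ξ : Boundary n, g • ξ = ξ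

/-- `ξ` is a bounded parabolic point: it is fixed by a parabolic element of `Γ`, and the quotient
of `Λ(Γ) \ {ξ}` by the stabilizer of `ξ` in `Γ` is compact. -/
def IsBoundedParabolicPoint (Γ : Subgroup (Isom n)) (ξ : Boundary n) : Prop :=
  (∃ g ∈ Γ, IsParabolic g ∧ g • ξ = ξ) ∧
    IsCompact ((Quotient.mk (MulAction.orbitRel
      ↥(Γ ⊓ MulAction.stabilizer (Isom n) ξ) (Boundary n))) '' (limitSet Γ \ {ξ}))

/-- Geometrical finiteness (Beardon and Maskit, Bowditch): a Kleinian group all of whose limit points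
are conical limit points or bounded parabolic points. -/
def IsGeometricallyFinite (Γ : Subgroup (Isom n)) : Prop :=
  IsKleinian Γ ∧ ∀ ξ ∈ limitSet Γ, IsConicalLimitPoint Γ ξ ∨ IsBoundedParabolicPoint Γ ξ

end HyperbolicSpace

end

/-!
A residually finite `G` has a finite-index normal subgroup `K` that meets the finite kernel of
`π : G →* Gbar` trivially. Let `σ` be the orthogonal regular representation of `G ⧸ K` on
`V = ℝ^(G ⧸ K)`. Then `g ↦ (ρbar (π g), σ (g K))` is an injective homomorphism to
`Isom(ℍⁿ) × O(V)`, and this product embeds into `Isom(ℍᵐ)` with `m = n + dim V`.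

The embedding (`warpHom`) is written in warped-product coordinates `ℍᵐ = ℍⁿ × V`, in which the
Lorentz pairing is `√(1 + ‖v‖ ^ 2) * √(1 + ‖w‖ ^ 2) * lorentz x y - ⟪v, w⟫` (`lorentz_warp`). So a
pair `(A, B)` acts by `(x, v) ↦ (A x, B v)`, and no linear extension of `A` to `ℝⁿ × ℝ` is needed.
The slice `v = 0` is a copy of `ℍⁿ` on which `ρ` acts through `ρbar`. All geometric properties
transfer along it:

* Discreteness: the projection `(x, v) ↦ x` is 1-Lipschitz, so restricting to the slice and
  projecting back is a continuous map from the image of `ρ` to the discrete image of `ρbar`, with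
  finite fibres (`isKleinian_warpGroup`).
* Convex cocompactness: moving off the slice strictly increases distances to its points, so the
  slice contains the geodesics between its points (`height_eq_zero_of_between`), and a convex hull
  for `ρbar` is one for `ρ` (`isConvexHull_image`).
* Geometrical finiteness: the limit set of `ρ` is that of `ρbar` in the sphere at infinity of the
  slice (`limitSet_warpGroup`). Conical points remain conical. A parabolic `A` gives a parabolic
  pair `(A, B)`, because a fixed point at infinity off the sphere of the slice has the Klein
  coordinates of a point of `ℍⁿ` fixed by `A` as its `ℝⁿ`-component
  (`exists_bdryIncl_eq_of_smul_eq`); hence bounded parabolic points remain bounded parabolic.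
-/

noncomputable section

namespace HyperbolicSpace

/-! ### Warped-product coordinates on hyperbolic space -/

section Warp

variable {n m : ℕ} {V : Type*} [NormedAddCommGroup V]

/-- The warping factor: `ℍᵐ` is the warped product `ℍⁿ × V` whose `ℍⁿ`-slice at height `v` is
scaled by `√(1 + ‖v‖ ^ 2)`. -/
def warpFactor (v : V) : ℝ := √(1 + ‖v‖ ^ 2)

theorem warpFactor_sq (v : V) : warpFactor v ^ 2 = 1 + ‖v‖ ^ 2 :=
  Real.sq_sqrt (by positivity)

theorem warpFactor_pos (v : V) : 0 < warpFactor v := Real.sqrt_pos.2 (by positivity)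

@[simp]
theorem warpFactor_zero : warpFactor (0 : V) = 1 := by simp [warpFactor]

theorem one_lt_warpFactor {v : V} (hv : v ≠ 0) : 1 < warpFactor v := by
  have := norm_pos_iff.2 hv
  nlinarith [warpFactor_sq v, warpFactor_pos v]

variable [InnerProductSpace ℝ V]
  (e : WithLp 2 (EuclideanSpace ℝ (Fin n) × V) ≃ₗᵢ[ℝ] EuclideanSpace ℝ (Fin m))

theorem warpFactor_map (B : V ≃ₗᵢ[ℝ] V) (v : V) : warpFactor (B v) = warpFactor v := by
  simp [warpFactor]

/-- Warped-product coordinates on `ℍᵐ`, where `ℝᵐ` is identified with `ℝⁿ × V` by `e`: the point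
at height `v` above the point `x` of `ℍⁿ`. The slice `v = 0` is a totally geodesic copy of `ℍⁿ`. -/
def warp (x : HyperbolicSpace n) (v : V) : HyperbolicSpace m where
  space := e (WithLp.toLp 2 (warpFactor v • x.space, v))
  time := warpFactor v * x.time
  time_pos := mul_pos (warpFactor_pos v) x.time_pos
  time_sq := by
    rw [LinearIsometryEquiv.norm_map, WithLp.prod_norm_sq_eq_of_L2]
    simp only [WithLp.toLp_fst, WithLp.toLp_snd, norm_smul, mul_pow, x.time_sq,
      Real.norm_eq_abs, sq_abs]
    rw [mul_add, warpFactor_sq]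
    ring

/-- The height coordinate of a point of `ℍᵐ`. -/
def height (z : HyperbolicSpace m) : V := (e.symm z.space).snd

/-- The base coordinate of a point of `ℍᵐ`, which is its nearest-point projection to `ℍⁿ`. -/
def base (z : HyperbolicSpace m) : HyperbolicSpace n where
  space := (warpFactor (height e z))⁻¹ • (e.symm z.space).fst
  time := (warpFactor (height e z))⁻¹ * z.time
  time_pos := mul_pos (inv_pos.2 (warpFactor_pos _)) z.time_pos
  time_sq := by
    have h : ‖z.space‖ ^ 2 = ‖(e.symm z.space).fst‖ ^ 2 + ‖height e z‖ ^ 2 := by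
      rw [← e.symm.norm_map z.space, WithLp.prod_norm_sq_eq_of_L2, height]
    have hs := warpFactor_sq (height e z)
    have hp := warpFactor_pos (height e z)
    rw [norm_smul, mul_pow, mul_pow, z.time_sq, h, Real.norm_eq_abs, sq_abs]
    field_simp
    rw [hs]
    ring

@[simp]
theorem height_warp (x : HyperbolicSpace n) (v : V) : height e (warp e x v) = v := by
  simp [height, warp]

@[simp]
theorem base_warp (x : HyperbolicSpace n) (v : V) : base e (warp e x v) = x := by
  have := (warpFactor_pos v).ne'
  apply HyperbolicSpace.ext
  · simp only [base, height_warp]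
    simp [warp, smul_smul, this]
  · simp only [base, height_warp]
    simp [warp, this]

@[simp]
theorem warp_base_height (z : HyperbolicSpace m) : warp e (base e z) (height e z) = z := by
  have := (warpFactor_pos (height e z)).ne'
  apply HyperbolicSpace.ext
  · simp only [warp, base, smul_smul, mul_inv_cancel₀ this, one_smul]
    rw [← e.symm.injective.eq_iff, e.symm_apply_apply]
    rfl
  · simp [warp, base, this]

theorem lorentz_warp (x y : HyperbolicSpace n) (v w : V) :
    lorentz (warp e x v) (warp e y w) =
      warpFactor v * warpFactor w * lorentz x y - inner ℝ v w := by
  simp only [lorentz, warp, LinearIsometryEquiv.inner_map_map, WithLp.prod_inner_apply,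
    real_inner_smul_left, real_inner_smul_right]
  ring

/-- The slice `v = 0` is an isometric copy of `ℍⁿ`. -/
theorem isometry_warp_zero : Isometry fun x : HyperbolicSpace n => warp e x 0 :=
  Isometry.of_dist_eq fun x y => by simp [dist_eq, lorentz_warp]

theorem lorentz_le_lorentz_warp (x y : HyperbolicSpace n) (v w : V) :
    lorentz x y ≤ lorentz (warp e x v) (warp e y w) := by
  have hv := warpFactor_sq v
  have hw := warpFactor_sq w
  have hpos := mul_pos (warpFactor_pos v) (warpFactor_pos w)
  have hvw : ‖v‖ * ‖w‖ + 1 ≤ warpFactor v * warpFactor w := by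
    apply le_of_sq_le_sq _ hpos.le
    rw [mul_pow, hv, hw]
    nlinarith [sq_nonneg (‖v‖ - ‖w‖)]
  have hn : 0 ≤ ‖v‖ * ‖w‖ := by positivity
  have h1 := real_inner_le_norm v w
  have h2 := one_le_lorentz x y
  rw [lorentz_warp]
  nlinarith

/-- The projection to `ℍⁿ` does not increase distances. -/
theorem dist_base_le (z w : HyperbolicSpace m) : dist (base e z) (base e w) ≤ dist z w := by
  have h := lorentz_le_lorentz_warp e (base e z) (base e w) (height e z) (height e w)
  rw [warp_base_height, warp_base_height] at h
  rw [dist_eq, dist_eq,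
    Real.arcosh_le_arcosh (by linarith [one_le_lorentz (base e z) (base e w)])
      (by linarith [one_le_lorentz z w])]
  exact h

theorem continuous_base : Continuous (base e) :=
  (LipschitzWith.of_dist_le_mul (K := 1) fun z w => by
    simpa using dist_base_le e z w).continuous

/-- Moving off the slice `v = 0` strictly increases the distance to the points of that slice. -/
theorem dist_lt_dist_warp (x y : HyperbolicSpace n) {v : V} (hv : v ≠ 0) :
    dist x y < dist (warp e x 0) (warp e y v) := by
  have h1 := one_lt_warpFactor hv
  have h2 := one_le_lorentz x y
  rw [dist_eq, dist_eq, Real.arcosh_lt_arcosh (by linarith)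
    (by linarith [one_le_lorentz (warp e x 0) (warp e y v)]), lorentz_warp]
  simp only [warpFactor_zero, inner_zero_left]
  nlinarith

/-- The slice `v = 0` contains the geodesic segments between its points, as projecting a point off
the slice would shorten a path through it. -/
theorem height_eq_zero_of_between {x y : HyperbolicSpace n} {z : HyperbolicSpace m}
    (h : dist (warp e x 0) z + dist z (warp e y 0) = dist (warp e x 0) (warp e y 0)) :
    height e z = 0 := by
  by_contra hz
  have h1 := dist_lt_dist_warp e x (base e z) hz
  have h2 := dist_lt_dist_warp e y (base e z) hz
  rw [warp_base_height] at h1 h2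
  have h3 := dist_triangle x (base e z) y
  rw [(isometry_warp_zero e).dist_eq, dist_comm z] at h
  rw [dist_comm y] at h2
  linarith

/-- An isometry of `ℍⁿ` and a linear isometry of `V` act together on `ℍᵐ` through the
warped-product coordinates. -/
def warpIsom (A : Isom n) (B : V ≃ₗᵢ[ℝ] V) : Isom m where
  toFun z := warp e (A (base e z)) (B (height e z))
  invFun z := warp e (A.symm (base e z)) (B.symm (height e z))
  left_inv z := by simp
  right_inv z := by simp
  isometry_toFun := Isometry.of_dist_eq fun z w => by
    conv_rhs => rw [← warp_base_height e z, ← warp_base_height e w]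
    simp only [dist_eq, lorentz_warp, warpFactor_map, lorentz_map,
      LinearIsometryEquiv.inner_map_map]

@[simp]
theorem warpIsom_warp (A : Isom n) (B : V ≃ₗᵢ[ℝ] V) (x : HyperbolicSpace n) (v : V) :
    warpIsom e A B (warp e x v) = warp e (A x) (B v) := by
  change warp e (A (base e (warp e x v))) (B (height e (warp e x v))) = _
  simp

/-- The embedding `Isom(ℍⁿ) × O(V) → Isom(ℍᵐ)`. -/
def warpHom : Isom n × (V ≃ₗᵢ[ℝ] V) →* Isom m where
  toFun p := warpIsom e p.1 p.2
  map_one' := IsometryEquiv.ext fun z => by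
    rw [← warp_base_height e z, warpIsom_warp]
    rfl
  map_mul' p q := IsometryEquiv.ext fun z => by
    change _ = warpIsom e p.1 p.2 (warpIsom e q.1 q.2 z)
    rw [← warp_base_height e z, warpIsom_warp, warpIsom_warp, warpIsom_warp]
    rfl

@[simp]
theorem warpHom_warp (p : Isom n × (V ≃ₗᵢ[ℝ] V)) (x : HyperbolicSpace n) (v : V) :
    warpHom e p (warp e x v) = warp e (p.1 x) (p.2 v) := warpIsom_warp e p.1 p.2 x v

theorem warpHom_injective : Function.Injective (warpHom e) := by
  intro p q h
  have key : ∀ x v, p.1 x = q.1 x ∧ p.2 v = q.2 v := fun x v => by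
    have h1 : warpHom e p (warp e x v) = warpHom e q (warp e x v) := by rw [h]
    rw [warpHom_warp, warpHom_warp] at h1
    exact ⟨by simpa using congrArg (base e) h1, by simpa using congrArg (height e) h1⟩
  exact Prod.ext (IsometryEquiv.ext fun x => (key x 0).1)
    (LinearIsometryEquiv.ext fun v => (key (origin n) v).2)

@[simp]
theorem warp_origin : warp e (origin n) 0 = origin m := by
  apply HyperbolicSpace.ext
  · simp only [warp, origin, ofSpace, smul_zero]
    exact map_zero e
  · simp [warp, origin, ofSpace]

/-! ### The sphere at infinity -/

/-- The isometric embedding `ℝⁿ → ℝᵐ` that extends the inclusion `ℍⁿ → ℍᵐ` in the Klein model. -/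
def ballIncl : EuclideanSpace ℝ (Fin n) →ₗᵢ[ℝ] EuclideanSpace ℝ (Fin m) where
  toFun u := e (WithLp.toLp 2 (u, 0))
  map_add' u v := by
    rw [← map_add]
    exact congrArg e (WithLp.ofLp_injective 2 (Prod.ext rfl (add_zero 0).symm))
  map_smul' c u := by
    change e (WithLp.toLp 2 (c • u, 0)) = c • e (WithLp.toLp 2 (u, 0))
    rw [← map_smul]
    exact congrArg e (WithLp.ofLp_injective 2 (Prod.ext rfl (smul_zero c).symm))
  norm_map' u := by
    change ‖e (WithLp.toLp 2 (u, 0))‖ = _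
    rw [LinearIsometryEquiv.norm_map]
    simp

theorem toBall_warp (x : HyperbolicSpace n) (v : V) :
    toBall (warp e x v) = e (WithLp.toLp 2 (toBall x, (warpFactor v * x.time)⁻¹ • v)) := by
  have h := (warpFactor_pos v).ne'
  rw [toBall, warp, ← map_smul, ← WithLp.toLp_smul, Prod.smul_mk, smul_smul, toBall]
  congr 4
  field_simp

theorem toBall_warp_zero (x : HyperbolicSpace n) :
    toBall (warp e x 0) = ballIncl e (toBall x) := by
  rw [toBall_warp, smul_zero]
  rfl

/-- The inclusion of the sphere at infinity of `ℍⁿ` into that of `ℍᵐ`. -/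
def bdryIncl (ξ : Boundary n) : Boundary m :=
  ⟨ballIncl e ξ, by simp⟩

theorem bdryIncl_injective : Function.Injective (bdryIncl e) := fun _ _ h =>
  Subtype.ext ((ballIncl e).injective (congrArg Subtype.val h))

theorem continuous_bdryIncl : Continuous (bdryIncl e) :=
  Continuous.subtype_mk ((ballIncl e).continuous.comp continuous_subtype_val) _

theorem tendsto_warp_zero (ξ : Boundary n) :
    Tendsto (fun x => warp e x 0) (atBoundary ξ) (atBoundary (bdryIncl e ξ)) := by
  refine tendsto_comap_iff.2 ?_
  have h : Tendsto toBall (atBoundary ξ) (𝓝 (ξ : EuclideanSpace ℝ (Fin n))) := tendsto_comap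
  exact (((ballIncl e).continuous.tendsto _).comp h).congr fun x => (toBall_warp_zero e x).symm

theorem warpHom_smul_bdryIncl (p : Isom n × (V ≃ₗᵢ[ℝ] V)) (ξ : Boundary n) :
    warpHom e p • bdryIncl e ξ = bdryIncl e (p.1 • ξ) := by
  refine boundary_unique (l := atBoundary ξ)
    ((tendsto_boundaryMap _ _).comp (tendsto_warp_zero e ξ)) ?_
  refine ((tendsto_warp_zero e _).comp (tendsto_boundaryMap p.1 ξ)).congr fun x => ?_
  simp

theorem toBall_injective : Function.Injective (toBall (n := n)) := by
  intro x y h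
  have ht : x.time⁻¹ = y.time⁻¹ := by
    have h1 := norm_toBall_sq x
    rw [h, norm_toBall_sq y] at h1
    rw [← sq_eq_sq₀ (inv_pos.2 x.time_pos).le (inv_pos.2 y.time_pos).le]
    linarith
  refine HyperbolicSpace.ext ?_ (inv_injective ht)
  rw [toBall, toBall, ht] at h
  exact smul_right_injective _ (inv_pos.2 y.time_pos).ne' h

theorem exists_toBall_eq {u : EuclideanSpace ℝ (Fin n)} (hu : ‖u‖ < 1) :
    ∃ x : HyperbolicSpace n, toBall x = u := by
  have hpos : 0 < 1 - ‖u‖ ^ 2 := by nlinarith [norm_nonneg u]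
  have hq : 0 < √(1 - ‖u‖ ^ 2) := Real.sqrt_pos.2 hpos
  have hq2 : √(1 - ‖u‖ ^ 2) ^ 2 = 1 - ‖u‖ ^ 2 := Real.sq_sqrt hpos.le
  refine ⟨⟨(√(1 - ‖u‖ ^ 2))⁻¹ • u, (√(1 - ‖u‖ ^ 2))⁻¹, inv_pos.2 hq, ?_⟩, ?_⟩
  · rw [norm_smul, Real.norm_eq_abs, mul_pow, sq_abs]
    field_simp
    rw [hq2]
    ring
  · simp only [toBall, inv_inv, smul_smul, mul_inv_cancel₀ hq.ne', one_smul]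

/-- The fibre of the projection `ℍᵐ → ℍⁿ` above `x` accumulates at infinity at points whose
`ℝⁿ`-component in the Klein model is that of `x`. -/
theorem tendsto_toBall_warp_ray (x : HyperbolicSpace n) {w : V} (hw : ‖w‖ = 1) :
    Tendsto (fun r : ℝ => toBall (warp e x (r • w))) atTop
      (𝓝 (e (WithLp.toLp 2 (toBall x, x.time⁻¹ • w)))) := by
  have h1 : Tendsto (fun r : ℝ => (warpFactor (r • w))⁻¹ * r) atTop (𝓝 1) := by
    have h2 : Tendsto (fun r : ℝ => (√(r⁻¹ ^ 2 + 1))⁻¹) atTop (𝓝 (√(0 ^ 2 + 1))⁻¹) :=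
      ((((tendsto_inv_atTop_zero (𝕜 := ℝ)).pow 2).add_const 1).sqrt).inv₀ (by simp)
    simp only [ne_eq, OfNat.ofNat_ne_zero, not_false_eq_true, zero_pow, zero_add, Real.sqrt_one,
      inv_one] at h2
    refine h2.congr' ?_
    filter_upwards [eventually_gt_atTop (0 : ℝ)] with r hr
    have h3 : warpFactor (r • w) = r * √(r⁻¹ ^ 2 + 1) := by
      rw [warpFactor, norm_smul, hw, mul_one, Real.norm_eq_abs, sq_abs,
        ← Real.sqrt_sq hr.le, ← Real.sqrt_mul (sq_nonneg r), Real.sqrt_sq hr.le]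
      congr 1
      field_simp
    rw [h3]
    field_simp
  have hc : Continuous fun s : ℝ => e (WithLp.toLp 2 (toBall x, (s * x.time⁻¹) • w)) := by
    refine e.continuous.comp ((WithLp.prod_continuous_toLp 2 _ _).comp ?_)
    fun_prop
  have h := (hc.tendsto 1).comp h1
  rw [one_mul] at h
  refine h.congr fun r => ?_
  simp only [Function.comp_apply, toBall_warp, smul_smul, mul_inv, mul_right_comm]

/-- A point at infinity of `ℍᵐ` fixed by `warpHom e p` lies in the sphere at infinity of `ℍⁿ`,
unless `p.1` fixes a point of `ℍⁿ`: otherwise its `ℝⁿ`-component lies in the open ball and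
represents such a fixed point. -/
theorem exists_bdryIncl_eq_of_smul_eq {p : Isom n × (V ≃ₗᵢ[ℝ] V)} (hp : ∀ x, p.1 x ≠ x)
    {η : Boundary m} (hη : warpHom e p • η = η) : ∃ ξ, bdryIncl e ξ = η := by
  set q := e.symm (η : EuclideanSpace ℝ (Fin m)) with hq
  have hnorm : ‖q.fst‖ ^ 2 + ‖q.snd‖ ^ 2 = 1 := by
    rw [← WithLp.prod_norm_sq_eq_of_L2, hq, LinearIsometryEquiv.norm_map]
    simp
  have hqη : e (WithLp.toLp 2 (q.fst, q.snd)) = (η : EuclideanSpace ℝ (Fin m)) :=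
    e.apply_symm_apply _
  by_cases hv : q.snd = 0
  · refine ⟨⟨q.fst, ?_⟩, ?_⟩
    · rw [hv] at hnorm
      simp only [norm_zero, ne_eq, OfNat.ofNat_ne_zero, not_false_eq_true, zero_pow,
        add_zero] at hnorm
      rw [mem_sphere_zero_iff_norm, ← sq_eq_sq₀ (norm_nonneg _) zero_le_one, hnorm, one_pow]
    · apply Subtype.ext
      change e (WithLp.toLp 2 (q.fst, 0)) = _
      rw [← hqη, hv]
  · exfalso
    -- `q.fst` is in the open ball, so it is the Klein model of a point `x`, and the fibre above
    -- `x` has a ray tending to `η`; its image lies above `p.1 x` and tends to `η` as well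
    have hv0 : 0 < ‖q.snd‖ := norm_pos_iff.2 hv
    have hu : ‖q.fst‖ < 1 := by nlinarith [norm_nonneg q.fst]
    obtain ⟨x, hx⟩ := exists_toBall_eq hu
    have ht : x.time⁻¹ = ‖q.snd‖ := by
      have h1 := norm_toBall_sq x
      rw [hx] at h1
      rw [← sq_eq_sq₀ (inv_pos.2 x.time_pos).le hv0.le]
      linarith
    set w : V := ‖q.snd‖⁻¹ • q.snd with hw
    have hw1 : ‖w‖ = 1 := by
      rw [hw, norm_smul, norm_inv, norm_norm, inv_mul_cancel₀ hv0.ne']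
    have h1 : Tendsto (fun r : ℝ => warp e x (r • w)) atTop (atBoundary η) := by
      rw [atBoundary, tendsto_comap_iff, ← hqη]
      have h := tendsto_toBall_warp_ray e x hw1
      rwa [hx, ht, hw, smul_smul, mul_inv_cancel₀ hv0.ne', one_smul] at h
    have h2 := (tendsto_boundaryMap (warpHom e p) η).comp h1
    change Tendsto _ _ (atBoundary (warpHom e p • η)) at h2
    rw [hη, atBoundary, tendsto_comap_iff] at h2
    have h3 := tendsto_toBall_warp_ray e (p.1 x) (w := p.2 w) (by simp [hw1])
    have h4 := tendsto_nhds_unique (h3.congr fun r => by simp) h2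
    rw [← hqη, e.injective.eq_iff] at h4
    have h5 : toBall (p.1 x) = q.fst := congrArg WithLp.fst h4
    exact hp x (toBall_injective (h5.trans hx.symm))

/-- A parabolic isometry of `ℍⁿ` remains parabolic on `ℍᵐ`: the projection to `ℍⁿ` would carry a
fixed point in `ℍᵐ` to one in `ℍⁿ`, and all fixed points at infinity come from `ℍⁿ`. -/
theorem IsParabolic.warpHom {p : Isom n × (V ≃ₗᵢ[ℝ] V)} (hp : IsParabolic p.1) :
    IsParabolic (warpHom e p) := by
  obtain ⟨hfix, ξ, hξ, huniq⟩ := hp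
  refine ⟨fun z hz => hfix (base e z) ?_, bdryIncl e ξ, ?_, fun η hη => ?_⟩
  · rw [← warp_base_height e z, warpHom_warp] at hz
    simpa using congrArg (base e) hz
  · simp only [warpHom_smul_bdryIncl, hξ]
  · obtain ⟨ζ, rfl⟩ := exists_bdryIncl_eq_of_smul_eq e hfix hη
    simp only [warpHom_smul_bdryIncl, (bdryIncl_injective e).eq_iff] at hη
    rw [huniq ζ hη]

end Warp

section Subgroups

variable {n m : ℕ} {V : Type*} [NormedAddCommGroup V] [InnerProductSpace ℝ V]
  (e : WithLp 2 (EuclideanSpace ℝ (Fin n) × V) ≃ₗᵢ[ℝ] EuclideanSpace ℝ (Fin m))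
  (Δ : Subgroup (Isom n × (V ≃ₗᵢ[ℝ] V)))

/-- The projection of `Δ` to `Isom(ℍⁿ)`. -/
abbrev baseGroup : Subgroup (Isom n) := Δ.map (MonoidHom.fst _ _)

/-- The image of `Δ` in `Isom(ℍᵐ)`. -/
abbrev warpGroup : Subgroup (Isom m) := Δ.map (warpHom e)

/-! ### Discreteness -/

/-- The underlying continuous map of an isometry. -/
def isomToContinuousMap (g : Isom n) : C(HyperbolicSpace n, HyperbolicSpace n) :=
  ⟨g, g.continuous⟩

theorem continuous_isomToContinuousMap : Continuous (isomToContinuousMap (n := n)) :=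
  continuous_induced_dom

theorem isomToContinuousMap_injective : Function.Injective (isomToContinuousMap (n := n)) :=
  fun _ _ h => IsometryEquiv.ext fun x => DFunLike.congr_fun h x

instance : T1Space (Isom n) :=
  t1Space_of_injective_of_continuous isomToContinuousMap_injective continuous_isomToContinuousMap

/-- Restricting an isometry of `ℍᵐ` to `ℍⁿ` and projecting back to `ℍⁿ`. -/
def compress (T : Isom m) : C(HyperbolicSpace n, HyperbolicSpace n) :=
  (ContinuousMap.mk (base e) (continuous_base e)).comp
    ((isomToContinuousMap T).comp
      ⟨fun x => warp e x 0, (isometry_warp_zero e).continuous⟩)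

theorem continuous_compress : Continuous (compress e) :=
  (ContinuousMap.continuous_postcomp _).comp
    ((ContinuousMap.continuous_precomp _).comp continuous_isomToContinuousMap)

theorem compress_warpHom (p : Isom n × (V ≃ₗᵢ[ℝ] V)) :
    compress e (warpHom e p) = isomToContinuousMap p.1 := by
  ext1 x
  change base e (warpHom e p (warp e x 0)) = p.1 x
  simp

/-- Compression maps `warpGroup e Δ` continuously onto a discrete set, with finite fibres. -/
theorem isKleinian_warpGroup (hfin : {p ∈ (Δ : Set (Isom n × (V ≃ₗᵢ[ℝ] V))) | p.1 = 1}.Finite)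
    (h : IsKleinian (baseGroup Δ)) : IsKleinian (warpGroup e Δ) := by
  rw [IsKleinian, discreteTopology_iff_isOpen_singleton] at h ⊢
  rintro ⟨_, p, hp, rfl⟩
  obtain ⟨O, hO, hOp⟩ := isOpen_induced_iff.1 (h ⟨p.1, p, hp, rfl⟩)
  obtain ⟨U, hU, rfl⟩ := isOpen_induced_iff.1 hO
  have hU' : ∀ q ∈ Δ, isomToContinuousMap q.1 ∈ U ↔ q.1 = p.1 := fun q hq => by
    exact (Set.ext_iff.1 hOp ⟨q.1, q, hq, rfl⟩).trans Subtype.ext_iff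
  -- the fibre of `Δ` above `p.1` is a translate of the fibre above `1`
  have hfib : {q ∈ (Δ : Set (Isom n × (V ≃ₗᵢ[ℝ] V))) | q.1 = p.1}.Finite := by
    refine (hfin.image fun q => p * q).subset fun q hq => ⟨p⁻¹ * q, ⟨?_, ?_⟩, ?_⟩
    · exact Δ.mul_mem (Δ.inv_mem hp) hq.1
    · simp [hq.2]
    · simp
  set S : Set (Isom m) :=
    warpHom e '' {q ∈ (Δ : Set (Isom n × (V ≃ₗᵢ[ℝ] V))) | q.1 = p.1} \ {warpHom e p} with hS
  have hSclosed : IsClosed S := ((hfib.image _).subset Set.sdiff_subset).isClosed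
  refine isOpen_induced_iff.2
    ⟨compress e ⁻¹' U \ S, (hU.preimage (continuous_compress e)).sdiff hSclosed, ?_⟩
  ext ⟨_, q, hq, rfl⟩
  rw [Set.mem_singleton_iff, Subtype.ext_iff]
  simp only [Set.mem_preimage, Set.mem_sdiff, Set.mem_singleton_iff, compress_warpHom,
    hU' q hq, hS]
  constructor
  · rintro ⟨h1, h2⟩
    by_contra h3
    exact h2 ⟨⟨q, ⟨hq, h1⟩, rfl⟩, h3⟩
  · intro h1
    exact ⟨by rw [warpHom_injective e h1], fun h2 => h2.2 h1⟩

/-! ### Convex cocompactness -/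

theorem isClosedEmbedding_warp_zero :
    IsClosedEmbedding fun x : HyperbolicSpace n => warp e x 0 :=
  Function.LeftInverse.isClosedEmbedding (f := base e) (fun x => base_warp e x 0)
    (continuous_base e) (isometry_warp_zero e).continuous

/-- A convex hull in `ℍⁿ` stays one in `ℍᵐ`: the slice is convex, and a smaller invariant set lies
in the slice, hence is an invariant set of `ℍⁿ`. -/
theorem isConvexHull_image {C : Set (HyperbolicSpace n)} (hC : IsConvexHull (baseGroup Δ) C) :
    IsConvexHull (warpGroup e Δ) ((fun x => warp e x 0) '' C) := by
  obtain ⟨⟨hne, hcl, hconv, hinv⟩, hmin⟩ := hC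
  have hiso := isometry_warp_zero e
  refine ⟨⟨hne.image _, (isClosedEmbedding_warp_zero e).isClosedMap C hcl, ?_, ?_⟩, ?_⟩
  · rintro _ ⟨x, hx, rfl⟩ _ ⟨y, hy, rfl⟩ z hz
    -- the segment between points of the slice stays in the slice, so it is a segment of `ℍⁿ`
    have hz0 := height_eq_zero_of_between e hz
    have hz1 := warp_base_height e z
    rw [hz0] at hz1
    refine ⟨base e z, hconv x hx y hy _ ?_, hz1⟩
    rw [← hz1] at hz
    simpa only [hiso.dist_eq] using hz
  · rintro _ ⟨p, hp, rfl⟩ _ ⟨x, hx, rfl⟩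
    exact ⟨p.1 x, hinv _ ⟨p, hp, rfl⟩ x hx, by simp⟩
  · rintro D ⟨hDne, hDcl, hDconv, hDinv⟩ hDC
    have hsub : (fun x => warp e x 0) ⁻¹' D ⊆ C := fun x hx => by
      obtain ⟨y, hy, hyx⟩ := hDC hx
      exact hiso.injective hyx ▸ hy
    have hle := hmin (y := (fun x => warp e x 0) ⁻¹' D) ⟨?_, hDcl.preimage hiso.continuous, ?_, ?_⟩
      hsub
    · rintro _ ⟨x, hx, rfl⟩
      exact hle hx
    · obtain ⟨z, hz⟩ := hDne
      obtain ⟨x, -, rfl⟩ := hDC hz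
      exact ⟨x, hz⟩
    · intro x hx y hy z hz
      refine hDconv _ hx _ hy _ ?_
      simpa only [hiso.dist_eq] using hz
    · rintro _ ⟨p, hp, rfl⟩ x hx
      have := hDinv _ ⟨p, hp, rfl⟩ _ hx
      simpa using this

theorem isConvexCocompact_warpGroup (hK : IsKleinian (warpGroup e Δ))
    (h : IsConvexCocompact (baseGroup Δ)) : IsConvexCocompact (warpGroup e Δ) := by
  obtain ⟨-, C, hC, hcomp⟩ := h
  refine ⟨hK, _, isConvexHull_image e Δ hC, ?_⟩
  let f : Quotient (MulAction.orbitRel (baseGroup Δ) (HyperbolicSpace n)) →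
      Quotient (MulAction.orbitRel (warpGroup e Δ) (HyperbolicSpace m)) :=
    Quotient.map (fun x => warp e x 0) (by
      rintro _ y ⟨⟨_, p, hp, rfl⟩, rfl⟩
      exact ⟨⟨_, p, hp, rfl⟩, by
        change warpHom e p (warp e y 0) = warp e (p.1 y) 0
        simp⟩)
  have hf : Continuous f := (isometry_warp_zero e).continuous.quotient_map' _
  have := hcomp.image hf
  rw [Set.image_image] at this ⊢
  exact this

/-! ### Geometrical finiteness -/

theorem limitSet_warpGroup : limitSet (warpGroup e Δ) = bdryIncl e '' limitSet (baseGroup Δ) := by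
  have himage : (fun g : Isom m => toBall (g (origin m))) '' (warpGroup e Δ : Set (Isom m)) =
      ballIncl e ''
        ((fun g : Isom n => toBall (g (origin n))) '' (baseGroup Δ : Set (Isom n))) := by
    simp only [Subgroup.coe_map, Set.image_image, ← warp_origin e, warpHom_warp, map_zero,
      toBall_warp_zero]
    rfl
  ext η
  rw [limitSet, Set.mem_ofPred_eq, himage,
    (ballIncl e).isometry.isClosedEmbedding.closure_image_eq]
  constructor
  · rintro ⟨u, hu, huη⟩
    have hu1 : ‖u‖ = 1 := by
      rw [← (ballIncl e).norm_map, huη]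
      simp
    exact ⟨⟨u, by simpa using hu1⟩, hu, Subtype.ext huη⟩
  · rintro ⟨ξ, hξ, rfl⟩
    exact ⟨ξ, hξ, rfl⟩

theorem isConicalLimitPoint_bdryIncl {ξ : Boundary n}
    (h : IsConicalLimitPoint (baseGroup Δ) ξ) :
    IsConicalLimitPoint (warpGroup e Δ) (bdryIncl e ξ) := by
  obtain ⟨c, R, hc, hξ, hR⟩ := h
  refine ⟨fun t => warp e (c t) 0, R, (isometry_warp_zero e).comp hc,
    (tendsto_warp_zero e ξ).comp hξ, hR.mono ?_⟩
  rintro t ⟨_, ⟨p, hp, rfl⟩, hpt⟩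
  refine ⟨_, ⟨p, hp, rfl⟩, ?_⟩
  rw [← warp_origin e, warpHom_warp, map_zero, (isometry_warp_zero e).dist_eq]
  exact hpt

theorem isBoundedParabolicPoint_bdryIncl {ξ : Boundary n}
    (h : IsBoundedParabolicPoint (baseGroup Δ) ξ) :
    IsBoundedParabolicPoint (warpGroup e Δ) (bdryIncl e ξ) := by
  obtain ⟨⟨_, ⟨p, hp, rfl⟩, hpar, hfix⟩, hcomp⟩ := h
  refine ⟨⟨_, ⟨p, hp, rfl⟩, IsParabolic.warpHom e hpar, ?_⟩, ?_⟩
  · rw [warpHom_smul_bdryIncl]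
    exact congrArg (bdryIncl e) hfix
  let f : Quotient (MulAction.orbitRel
        ↥(baseGroup Δ ⊓ MulAction.stabilizer (Isom n) ξ) (Boundary n)) →
      Quotient (MulAction.orbitRel
        ↥(warpGroup e Δ ⊓ MulAction.stabilizer (Isom m) (bdryIncl e ξ)) (Boundary m)) :=
    Quotient.map (bdryIncl e) (by
      rintro _ ζ ⟨⟨_, ⟨q, hq, rfl⟩, hqξ⟩, rfl⟩
      refine ⟨⟨warpHom e q, ⟨q, hq, rfl⟩, ?_⟩, warpHom_smul_bdryIncl e q ζ⟩
      exact (warpHom_smul_bdryIncl e q ξ).trans (congrArg (bdryIncl e) hqξ))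
  have hf : Continuous f := (continuous_bdryIncl e).quotient_map' _
  have := hcomp.image hf
  rw [limitSet_warpGroup, ← Set.image_singleton, ← Set.image_sdiff (bdryIncl_injective e)]
  rw [Set.image_image] at this ⊢
  exact this

theorem isGeometricallyFinite_warpGroup (hK : IsKleinian (warpGroup e Δ))
    (h : IsGeometricallyFinite (baseGroup Δ)) : IsGeometricallyFinite (warpGroup e Δ) := by
  refine ⟨hK, fun η hη => ?_⟩
  rw [limitSet_warpGroup] at hη
  obtain ⟨ξ, hξ, rfl⟩ := hη
  exact (h.2 ξ hξ).imp (isConicalLimitPoint_bdryIncl e Δ) (isBoundedParabolicPoint_bdryIncl e Δ)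

end Subgroups
end HyperbolicSpace

/-! ### Finite quotients and their regular representations -/

/-- A finite subset of a residually finite group is separated from `1` by one finite-index normal
subgroup. -/
theorem Group.ResiduallyFinite.exists_finiteIndex_normal_disjoint {G : Type*} [Group G]
    [Group.ResiduallyFinite G] {S : Set G} (hS : S.Finite) :
    ∃ K : Subgroup G, K.Normal ∧ K.FiniteIndex ∧ ∀ g ∈ S, g ∈ K → g = 1 := by
  induction S, hS using Set.Finite.induction_on with
  | empty => exact ⟨⊤, inferInstance, inferInstance, by simp⟩
  | @insert a S _ _ ih =>
    obtain ⟨K, hK, hKf, hKS⟩ := ih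
    by_cases ha : a = 1
    · refine ⟨K, hK, hKf, fun g hg hgK => ?_⟩
      rcases hg with rfl | hg
      exacts [ha, hKS g hg hgK]
    · obtain ⟨H, hH⟩ := Group.exists_finiteIndexNormalSubgroup_notMem a ha
      have := H.isNormal'
      have := H.isFiniteIndex'
      refine ⟨K ⊓ H.toSubgroup, inferInstance, inferInstance, fun g hg hgK => ?_⟩
      rcases hg with rfl | hg
      exacts [absurd hgK.2 hH, hKS g hg hgK.1]

/-- The orthogonal regular representation of a finite group. -/
def regularRep (Q : Type*) [Group Q] [Fintype Q] :
    Q →* (EuclideanSpace ℝ Q ≃ₗᵢ[ℝ] EuclideanSpace ℝ Q) where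
  toFun q := LinearIsometryEquiv.piLpCongrLeft 2 ℝ ℝ (Equiv.mulLeft q)
  map_one' := by
    ext v i
    exact congrArg v (show (1 : Q)⁻¹ * i = i by simp)
  map_mul' a b := by
    ext v i
    exact congrArg v (show (a * b)⁻¹ * i = b⁻¹ * (a⁻¹ * i) by simp [mul_assoc])

theorem regularRep_injective (Q : Type*) [Group Q] [Fintype Q] :
    Function.Injective (regularRep Q) := by
  classical
  intro a b h
  have h1 := DFunLike.congr_fun h (EuclideanSpace.single 1 (1 : ℝ))
  change LinearIsometryEquiv.piLpCongrLeft 2 ℝ ℝ (Equiv.mulLeft a) _ =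
    LinearIsometryEquiv.piLpCongrLeft 2 ℝ ℝ (Equiv.mulLeft b) _ at h1
  rw [LinearIsometryEquiv.piLpCongrLeft_single, LinearIsometryEquiv.piLpCongrLeft_single] at h1
  by_contra hab
  have h2 := congrArg (fun v : EuclideanSpace ℝ Q => v a) h1
  simp [hab] at h2

end

theorem mainTheorem6 {F G Gbar : Type*} [Group F] [Group G] [Group Gbar]
    [Finite F] [Group.ResiduallyFinite G]
    (ι : F →* G) (π : G →* Gbar)
    (hι : Function.Injective ι) (hπ : Function.Surjective π) (hex : ι.range = π.ker)
    (n : ℕ) (ρbar : Gbar →* HyperbolicSpace.Isom n) (hfaithful : Function.Injective ρbar)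
    (hdiscrete : HyperbolicSpace.IsKleinian ρbar.range) :
    ∃ (m : ℕ) (ρ : G →* HyperbolicSpace.Isom m),
      Function.Injective ρ ∧
      HyperbolicSpace.IsKleinian ρ.range ∧
      (HyperbolicSpace.IsConvexCocompact ρbar.range →
        HyperbolicSpace.IsConvexCocompact ρ.range) ∧
      (HyperbolicSpace.IsGeometricallyFinite ρbar.range →
        HyperbolicSpace.IsGeometricallyFinite ρ.range) := by
  have hker : (π.ker : Set G).Finite := by
    rw [← hex, MonoidHom.coe_range]
    exact Set.finite_range ι
  -- `K` is a finite-index normal subgroup that meets the kernel of `π` trivially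
  obtain ⟨K, hK, hKf, hKker⟩ :=
    Group.ResiduallyFinite.exists_finiteIndex_normal_disjoint hker
  let _ : Fintype (G ⧸ K) := Fintype.ofFinite _
  let E := WithLp 2 (EuclideanSpace ℝ (Fin n) × EuclideanSpace ℝ (G ⧸ K))
  let e : E ≃ₗᵢ[ℝ] EuclideanSpace ℝ (Fin (Module.finrank ℝ E)) :=
    (stdOrthonormalBasis ℝ E).repr
  let φ : G →* HyperbolicSpace.Isom n ×
      (EuclideanSpace ℝ (G ⧸ K) ≃ₗᵢ[ℝ] EuclideanSpace ℝ (G ⧸ K)) :=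
    (ρbar.comp π).prod ((regularRep (G ⧸ K)).comp (QuotientGroup.mk' K))
  have hφker : ∀ g, (φ g).1 = 1 → g ∈ π.ker := fun g hg =>
    hfaithful ((show ρbar (π g) = 1 from hg).trans (map_one ρbar).symm)
  have hφ : Function.Injective φ := by
    refine (injective_iff_map_eq_one φ).2 fun g hg => ?_
    refine hKker g (hφker g (congrArg Prod.fst hg)) ?_
    have h2 : regularRep (G ⧸ K) (g : G ⧸ K) = 1 := congrArg Prod.snd hg
    exact (QuotientGroup.eq_one_iff g).1
      (regularRep_injective (G ⧸ K) (h2.trans (map_one _).symm))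
  have hbase : HyperbolicSpace.baseGroup φ.range = ρbar.range := by
    rw [HyperbolicSpace.baseGroup, MonoidHom.map_range, MonoidHom.fst_comp_prod,
      ← MonoidHom.map_range, MonoidHom.range_eq_top.2 hπ, ← MonoidHom.range_eq_map]
  have hwarp : ((HyperbolicSpace.warpHom e).comp φ).range =
      HyperbolicSpace.warpGroup e φ.range := by
    rw [HyperbolicSpace.warpGroup, MonoidHom.map_range]
  have hkl : HyperbolicSpace.IsKleinian (HyperbolicSpace.warpGroup e φ.range) := by
    refine HyperbolicSpace.isKleinian_warpGroup e _ ((hker.image φ).subset ?_) (hbase ▸ hdiscrete)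
    rintro _ ⟨⟨g, rfl⟩, hg⟩
    exact ⟨g, hφker g hg, rfl⟩
  refine ⟨_, (HyperbolicSpace.warpHom e).comp φ,
    (HyperbolicSpace.warpHom_injective e).comp hφ, ?_⟩
  rw [hwarp, ← hbase]
  exact ⟨hkl, HyperbolicSpace.isConvexCocompact_warpGroup e _ hkl,
    HyperbolicSpace.isGeometricallyFinite_warpGroup e _ hkl⟩
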